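/- For each $n\ge n_0$ let $\mathcal F_n$ be a probability distribution on $\{0,1\}^n$, regarded as the law of a vector $(Y_{n,1},\dots,Y_{n,n})$ of binary item responses. Let $\{P_{n,i}\}$ and $\{P^*_{n,i}\}$ ($n\ge n_0$, $1\le i\le n$) be two triangular arrays of functions on $(0,1)$ (item response functions) such that both, coupled with a latent trait uniformly distributed on $(0,1)$, are locally independent models for $(\mathcal F_n)_{n\ge n_0}$: for every $n\ge n_0$ and every nonempty $\{i_1,\dots,i_k\}\subseteq\{1,\dots,n\}$, $$\mathcal F_n[Y_{n,i_1}=1,\dots,Y_{n,i_k}=1]=\int_0^1\prod_{j=1}^kP_{n,i_j}(\theta)\,d\theta=\int_0^1\prod_{j=1}^kP^*_{n,i_j}(\theta)\,d\theta .$$ Suppose that each of the two arrays, written $\{P_{n,i}\}$ here, satisfies the following conditions. (a) Each $P_{n,i}$ is continuously differentiable on $(0,1)$, and for all $0<\alpha<\beta<1$ there are constants $0<m_{\alpha\beta}<M_{\alpha\beta}<\infty$, not depending on $(n,i)$, such that $m_{\alpha\beta}<P_{n,i}'(\theta)<M_{\alpha\beta}$ for all $\theta\in[\alpha,\beta]$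 and all $(n,i)$. (b) There are constants $0\le\kappa_{n,i}<\gamma_{n,i}\le1$ with $P_{n,i}(\theta)\in[\kappa_{n,i},\gamma_{n,i}]$ for all $\theta\in(0,1)$, and for every $\epsilon>0$ there are $l_\epsilon,u_\epsilon\in(0,1)$, not depending on $(n,i)$, such that $P_{n,i}(\theta)-\kappa_{n,i}\le\epsilon$ for all $\theta\in(0,l_\epsilon]$ and $\gamma_{n,i}-P_{n,i}(\theta)\le\epsilon$ for all $\theta\in[u_\epsilon,1)$, for all $(n,i)$. Then for every $\epsilon>0$ and all $0<\alpha<\beta<1$ there is $N\ge n_0$ such that for all $n\ge N$, $$\max_{1\le i\le n}\ \sup_{\theta\in(\alpha,\beta)}\bigl|P_{n,i}(\theta)-P^*_{n,i}(\theta)\bigr|<\epsilon .$$ -/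

import Mathlib

open Set MeasureTheory

/-- A triangular array of item response functions: `P n i θ` is the probability that a person
of ability `θ` answers correctly the `i`-th of the `n` items in the `n`-th row.  Only the values
at `θ ∈ (0, 1)` are ever used. -/
abbrev IRFArray : Type := (n : ℕ) → Fin n → ℝ → ℝ

/-- A triangular array of manifest distributions: `F n` is the law of the vector
`(Y_{n,1}, …, Y_{n,n})` of dichotomous item responses (`true` is a correct answer). -/
abbrev ManifestArray : Type := (n : ℕ) → Measure (Fin n → Bool)

/-- The density of the uniform distribution on `(0, 1)`. -/
noncomputable def uniformDensity : ℝ → ℝ := (Ioo (0 : ℝ) 1).indicator 1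

/-- The rows `n ≥ n₀` of the array `P`, coupled with the density `f` of a scalar latent trait,
are a locally independent item response model for the manifest distributions `F`:
for all `n ≥ n₀` and every nonempty set `S` of items,
`F_n [Y_{n,i} = 1 for all i ∈ S] = ∫ ∏_{i ∈ S} P_{n,i}(θ) f(θ) dθ`. -/
def IsModel (n₀ : ℕ) (P : IRFArray) (f : ℝ → ℝ) (F : ManifestArray) : Prop :=
  ∀ n, n₀ ≤ n → ∀ S : Finset (Fin n), S.Nonempty →
    (F n).real {y | ∀ i ∈ S, y i = true} = ∫ θ, (∏ i ∈ S, P n i θ) * f θ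

/-- The derivatives `P_{n,i}'` exist and are continuous on `(0, 1)`, and on each
`[α, β] ⊆ (0, 1)` they lie strictly between two positive constants independent of `(n, i)`. -/
def DerivBounds (n₀ : ℕ) (P : IRFArray) : Prop :=
  (∀ n, n₀ ≤ n → ∀ i : Fin n,
    DifferentiableOn ℝ (P n i) (Ioo 0 1) ∧ ContinuousOn (deriv (P n i)) (Ioo 0 1)) ∧
  ∀ α β : ℝ, 0 < α → α < β → β < 1 →
    ∃ m M : ℝ, 0 < m ∧ ∀ n, n₀ ≤ n → ∀ i : Fin n, ∀ θ ∈ Icc α β,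
      m < deriv (P n i) θ ∧ deriv (P n i) θ < M

/-- Each `P_{n,i}` takes its values in an interval `[κ_{n,i}, γ_{n,i}] ⊆ [0, 1]`, with
`κ_{n,i} < γ_{n,i}`, and is close to `κ_{n,i}` near `0` and to `γ_{n,i}` near `1`, uniformly in
`(n, i)`. -/
def UniformEndpoints (n₀ : ℕ) (P : IRFArray) : Prop :=
  ∃ κ γ : (n : ℕ) → Fin n → ℝ,
    (∀ n, n₀ ≤ n → ∀ i : Fin n, 0 ≤ κ n i ∧ κ n i < γ n i ∧ γ n i ≤ 1 ∧
      ∀ θ ∈ Ioo (0 : ℝ) 1, P n i θ ∈ Icc (κ n i) (γ n i)) ∧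
    ∀ ε : ℝ, 0 < ε → ∃ l ∈ Ioo (0 : ℝ) 1, ∃ u ∈ Ioo (0 : ℝ) 1,
      ∀ n, n₀ ≤ n → ∀ i : Fin n,
        (∀ θ ∈ Ioc 0 l, P n i θ - κ n i ≤ ε) ∧ (∀ θ ∈ Ico u 1, γ n i - P n i θ ≤ ε)

/-! The row mean is a proxy for the latent trait. A moment that multiplies a product over `S` by a
power of the mean expands into square-free moments, except for terms with repeated indices, which
carry weight O(1/n). Hence such moments agree for both arrays up to O(1/n), and by Weierstrass so
do, in the limit, integrals with a continuous function of the mean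
(`exists_forall_abs_integral_prod_mul_comp_sub_le`).

For empty `S`, the two means have asymptotically equal laws. Each mean is increasing with slopes
bounded on compact subintervals, so it is the quantile function of its law, and the two means are
close (`exists_forall_familyMean_le_add`).

For `S = {i}`, a tent function of the mean localises the integral at a chosen θ, because the mean
has slope bounded below. Replacing one mean by the other costs little, so local averages of the two
item functions nearly agree; uniform Lipschitz bounds turn this into a pointwise estimate
(`AreMatched.exists_forall_le_add`). -/

/-! ### Unit-valued families and their means -/

/-- A finite family of almost everywhere `[0, 1]`-valued measurable functions. -/
structure IsUnitFamily {Ω ι : Type*} [MeasurableSpace Ω] (μ : Measure Ω) (p : ι → Ω → ℝ) :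
    Prop where
  aestronglyMeasurable : ∀ i, AEStronglyMeasurable (p i) μ
  mem_Icc : ∀ i, ∀ᵐ x ∂μ, p i x ∈ Icc (0 : ℝ) 1

/-- The average of the functions in a family. -/
noncomputable def familyMean {Ω : Type*} {n : ℕ} (p : Fin n → Ω → ℝ) (x : Ω) : ℝ :=
  (∑ i, p i x) / n

/-- Two families with the same square-free mixed moments. -/
structure HaveEqualMoments {Ω ι : Type*} [MeasurableSpace Ω] (μ : Measure Ω) (p q : ι → Ω → ℝ) :
    Prop where
  left : IsUnitFamily μ p
  right : IsUnitFamily μ q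
  integral_prod_eq : ∀ S : Finset ι, ∫ x, ∏ i ∈ S, p i x ∂μ = ∫ x, ∏ i ∈ S, q i x ∂μ

theorem HaveEqualMoments.symm {Ω ι : Type*} [MeasurableSpace Ω] {μ : Measure Ω}
    {p q : ι → Ω → ℝ} (h : HaveEqualMoments μ p q) : HaveEqualMoments μ q p :=
  ⟨h.right, h.left, fun S => (h.integral_prod_eq S).symm⟩

theorem familyMean_mem_Icc {Ω : Type*} {n : ℕ} {p : Fin n → Ω → ℝ} {x : Ω}
    (h : ∀ i, p i x ∈ Icc (0 : ℝ) 1) : familyMean p x ∈ Icc (0 : ℝ) 1 := by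
  refine ⟨div_nonneg (Finset.sum_nonneg fun i _ => (h i).1) (Nat.cast_nonneg n), ?_⟩
  refine div_le_one_of_le₀ ?_ (Nat.cast_nonneg n)
  calc ∑ i, p i x ≤ ∑ _i : Fin n, (1 : ℝ) := Finset.sum_le_sum fun i _ => (h i).2
    _ = n := by simp

namespace IsUnitFamily

variable {Ω : Type*} [MeasurableSpace Ω] {μ : Measure Ω} {n : ℕ} {p : Fin n → Ω → ℝ}

theorem ae_forall_mem_Icc (h : IsUnitFamily μ p) : ∀ᵐ x ∂μ, ∀ i, p i x ∈ Icc (0 : ℝ) 1 :=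
  ae_all_iff.2 h.mem_Icc

theorem aestronglyMeasurable_familyMean (h : IsUnitFamily μ p) :
    AEStronglyMeasurable (familyMean p) μ := by
  have : AEStronglyMeasurable (fun x => ∑ i, p i x) μ :=
    Finset.aestronglyMeasurable_fun_sum _ fun i _ => h.aestronglyMeasurable i
  exact (this.mul_const ((n : ℝ)⁻¹)).congr (.of_forall fun x => (div_eq_mul_inv _ _).symm)

theorem aestronglyMeasurable_prod (h : IsUnitFamily μ p) (S : Finset (Fin n)) :
    AEStronglyMeasurable (fun x => ∏ i ∈ S, p i x) μ :=
  Finset.aestronglyMeasurable_fun_prod _ fun i _ => h.aestronglyMeasurable i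

theorem aestronglyMeasurable_comp_familyMean (h : IsUnitFamily μ p) {φ : ℝ → ℝ}
    (hφ : Continuous φ) (a : ℝ) : AEStronglyMeasurable (fun x => φ (familyMean p x - a)) μ :=
  (hφ.comp (continuous_id.sub continuous_const)).comp_aestronglyMeasurable
    h.aestronglyMeasurable_familyMean

theorem ae_abs_prod_le_one (h : IsUnitFamily μ p) (S : Finset (Fin n)) :
    ∀ᵐ x ∂μ, |∏ i ∈ S, p i x| ≤ 1 := by
  filter_upwards [h.ae_forall_mem_Icc] with x hx
  rw [abs_of_nonneg (Finset.prod_nonneg fun i _ => (hx i).1)]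
  exact Finset.prod_le_one (fun i _ => (hx i).1) fun i _ => (hx i).2

theorem ae_abs_familyMean_sub_le_one (h : IsUnitFamily μ p) {a : ℝ} (ha : a ∈ Icc (0 : ℝ) 1) :
    ∀ᵐ x ∂μ, |familyMean p x - a| ≤ 1 := by
  filter_upwards [h.ae_forall_mem_Icc] with x hx
  have := familyMean_mem_Icc hx
  exact abs_le.2 ⟨by linarith [this.1, ha.2], by linarith [this.2, ha.1]⟩

theorem integrable_prod_mul_comp [IsFiniteMeasure μ] (h : IsUnitFamily μ p) (S : Finset (Fin n))
    {φ : ℝ → ℝ} (hφ : Continuous φ) {a : ℝ} (ha : a ∈ Icc (0 : ℝ) 1) :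
    Integrable (fun x => (∏ i ∈ S, p i x) * φ (familyMean p x - a)) μ := by
  obtain ⟨C, hC⟩ := (isCompact_Icc (a := (-1 : ℝ)) (b := 1)).exists_bound_of_continuousOn
    hφ.continuousOn
  refine Integrable.of_bound ((h.aestronglyMeasurable_prod S).mul
    (h.aestronglyMeasurable_comp_familyMean hφ a)) C ?_
  filter_upwards [h.ae_abs_prod_le_one S, h.ae_abs_familyMean_sub_le_one ha] with x h1 h2
  have h3 := hC _ (abs_le.1 h2)
  rw [norm_mul]
  calc _ ≤ 1 * ‖φ (familyMean p x - a)‖ := by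
        gcongr; exact h1
    _ ≤ C := by rwa [one_mul]

theorem integrable_prod_mul_pow_mul [IsFiniteMeasure μ] (h : IsUnitFamily μ p)
    (S : Finset (Fin n)) (k : ℕ) (j : Fin n) {a : ℝ} (ha : a ∈ Icc (0 : ℝ) 1) :
    Integrable (fun x => p j x * ((∏ i ∈ S, p i x) * (familyMean p x - a) ^ k)) μ := by
  refine (h.integrable_prod_mul_comp S (continuous_pow k) ha).bdd_mul (c := 1)
    (h.aestronglyMeasurable j) ?_
  filter_upwards [h.mem_Icc j] with x hx
  rw [Real.norm_eq_abs, abs_of_nonneg hx.1]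
  exact hx.2

theorem abs_integral_prod_mul_pow_mul_le [IsProbabilityMeasure μ] (h : IsUnitFamily μ p)
    (S : Finset (Fin n)) (k : ℕ) (j : Fin n) {a : ℝ} (ha : a ∈ Icc (0 : ℝ) 1) :
    |∫ x, p j x * ((∏ i ∈ S, p i x) * (familyMean p x - a) ^ k) ∂μ| ≤ 1 := by
  have := norm_integral_le_of_norm_le_const (μ := μ) (C := 1)
    (f := fun x => p j x * ((∏ i ∈ S, p i x) * (familyMean p x - a) ^ k)) ?_
  · simpa using this
  filter_upwards [h.ae_abs_prod_le_one S, h.ae_abs_familyMean_sub_le_one ha, h.mem_Icc j]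
    with x h1 h2 h3
  rw [Real.norm_eq_abs, abs_mul, abs_mul, abs_pow, abs_of_nonneg h3.1]
  exact mul_le_one₀ h3.2 (by positivity) (mul_le_one₀ h1 (by positivity)
    (pow_le_one₀ (abs_nonneg _) h2))

/-- Writing one factor of the mean as an average over `j` lowers the power by one; for `j ∉ S` the
extra factor merely enlarges `S`, which drives the induction on the power. -/
theorem integral_prod_mul_pow_succ [IsProbabilityMeasure μ] (h : IsUnitFamily μ p)
    (S : Finset (Fin n)) (k : ℕ) {a : ℝ} (ha : a ∈ Icc (0 : ℝ) 1) :
    ∫ x, (∏ i ∈ S, p i x) * (familyMean p x - a) ^ (k + 1) ∂μ =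
      (∑ j, ∫ x, p j x * ((∏ i ∈ S, p i x) * (familyMean p x - a) ^ k) ∂μ) / n -
        a * ∫ x, (∏ i ∈ S, p i x) * (familyMean p x - a) ^ k ∂μ := by
  have h1 := fun j : Fin n => h.integrable_prod_mul_pow_mul S k j ha
  have h2 := h.integrable_prod_mul_comp S (continuous_pow k) ha
  rw [← integral_finsetSum _ fun j _ => h1 j, ← integral_div, ← integral_const_mul,
    ← integral_sub ((integrable_finsetSum _ fun j _ => h1 j).div_const _) (h2.const_mul a)]
  congr 1 with x
  rw [← Finset.sum_mul, pow_succ]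
  conv_lhs => rw [familyMean]
  rw [← familyMean, mul_div_right_comm, ← familyMean]
  ring

end IsUnitFamily

/-! ### Asymptotic equality of moments involving the mean -/

/-- Equality of the square-free moments makes the moments that involve powers of the mean
agree up to an error of order `1 / n`. -/
theorem exists_abs_integral_prod_mul_pow_sub_le {Ω : Type*} [MeasurableSpace Ω] (μ : Measure Ω)
    [IsProbabilityMeasure μ] (k s : ℕ) :
    ∃ C : ℝ, ∀ n : ℕ, 0 < n → ∀ p q : Fin n → Ω → ℝ, HaveEqualMoments μ p q →
      ∀ S : Finset (Fin n), S.card = s → ∀ a ∈ Icc (0 : ℝ) 1,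
        |∫ x, (∏ i ∈ S, p i x) * (familyMean p x - a) ^ k ∂μ -
          ∫ x, (∏ i ∈ S, q i x) * (familyMean q x - a) ^ k ∂μ| ≤ C / n := by
  induction k generalizing s with
  | zero =>
    refine ⟨0, fun n _ p q h S _ a _ => ?_⟩
    simp [h.integral_prod_eq S]
  | succ k ih =>
    obtain ⟨C₀, h₀⟩ := ih s
    obtain ⟨C₁, h₁⟩ := ih (s + 1)
    -- The average over `j ∉ S` contributes `C₁`, the `s` indices in `S` contribute at most 2 each
    -- before division by `n`, and the shift by `a` contributes `C₀`.
    refine ⟨|C₁| + 2 * s + C₀, fun n hn p q h S hS a ha => ?_⟩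
    have hn' : (0 : ℝ) < n := by exact_mod_cast hn
    rw [h.left.integral_prod_mul_pow_succ S k ha, h.right.integral_prod_mul_pow_succ S k ha]
    set A : Fin n → ℝ := fun j => ∫ x, p j x * ((∏ i ∈ S, p i x) * (familyMean p x - a) ^ k) ∂μ
      with hA
    set B : Fin n → ℝ := fun j => ∫ x, q j x * ((∏ i ∈ S, q i x) * (familyMean q x - a) ^ k) ∂μ
      with hB
    have hD := h₀ n hn p q h S hS a ha
    -- For `j ∈ S` the factor `p j` would be squared, so the moments give no information and only
    -- the trivial bound is available.
    have hAB : ∀ j, |A j - B j| ≤ |C₁| / n + if j ∈ S then 2 else 0 := by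
      intro j
      split_ifs with hj
      · have h2 := h.left.abs_integral_prod_mul_pow_mul_le S k j ha
        have h3 := h.right.abs_integral_prod_mul_pow_mul_le S k j ha
        have : |A j - B j| ≤ 2 := (abs_sub _ _).trans (by linarith)
        have : 0 ≤ |C₁| / n := by positivity
        linarith
      · have h2 := h₁ n hn p q h (insert j S) (by rw [Finset.card_insert_of_notMem hj, hS]) a ha
        simp only [Finset.prod_insert hj, mul_assoc] at h2
        rw [add_zero]
        exact h2.trans (by gcongr; exact le_abs_self _)
    have hsum : |∑ j, A j - ∑ j, B j| ≤ |C₁| + 2 * s := by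
      rw [← Finset.sum_sub_distrib]
      refine (Finset.abs_sum_le_sum_abs _ _).trans ((Finset.sum_le_sum fun j _ => hAB j).trans ?_)
      rw [Finset.sum_add_distrib, Finset.sum_ite_mem]
      simp only [Finset.sum_const, Finset.card_univ, Fintype.card_fin, nsmul_eq_mul,
        Finset.univ_inter, hS]
      rw [mul_div_cancel₀ _ hn'.ne', mul_comm (2 : ℝ)]
    set X := ∫ x, (∏ i ∈ S, p i x) * (familyMean p x - a) ^ k ∂μ
    set Y := ∫ x, (∏ i ∈ S, q i x) * (familyMean q x - a) ^ k ∂μ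
    calc |(∑ j, A j) / n - a * X - ((∑ j, B j) / n - a * Y)|
        = |(∑ j, A j - ∑ j, B j) / n - a * (X - Y)| := by congr 1; ring
      _ ≤ |(∑ j, A j - ∑ j, B j) / n| + |a * (X - Y)| := abs_sub _ _
      _ ≤ (|C₁| + 2 * s) / n + 1 * (C₀ / n) := by
        rw [abs_div, abs_mul, Nat.abs_cast, abs_of_nonneg ha.1]
        gcongr
        exact ha.2
      _ = (|C₁| + 2 * s + C₀) / n := by ring

/-- For polynomials `φ`, the integrals of `(∏ i ∈ S, p i) * φ (familyMean p - a)` and of its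
analogue for `q` differ by `O (1 / n)`. -/
theorem exists_abs_integral_prod_mul_eval_sub_le {Ω : Type*} [MeasurableSpace Ω] (μ : Measure Ω)
    [IsProbabilityMeasure μ] (P : Polynomial ℝ) (s : ℕ) :
    ∃ C : ℝ, ∀ n : ℕ, 0 < n → ∀ p q : Fin n → Ω → ℝ, HaveEqualMoments μ p q →
      ∀ S : Finset (Fin n), S.card = s → ∀ a ∈ Icc (0 : ℝ) 1,
        |∫ x, (∏ i ∈ S, p i x) * P.eval (familyMean p x - a) ∂μ -
          ∫ x, (∏ i ∈ S, q i x) * P.eval (familyMean q x - a) ∂μ| ≤ C / n := by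
  induction P using Polynomial.induction_on' with
  | add P R hP hR =>
    obtain ⟨C, hC⟩ := hP
    obtain ⟨D, hD⟩ := hR
    refine ⟨C + D, fun n hn p q h S hS a ha => ?_⟩
    have hl := fun P : Polynomial ℝ => h.left.integrable_prod_mul_comp S P.continuous ha
    have hr := fun P : Polynomial ℝ => h.right.integrable_prod_mul_comp S P.continuous ha
    simp only [Polynomial.eval_add, mul_add]
    rw [integral_add (hl P) (hl R), integral_add (hr P) (hr R), add_sub_add_comm, add_div]
    exact (abs_add_le _ _).trans (add_le_add (hC n hn p q h S hS a ha) (hD n hn p q h S hS a ha))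
  | monomial k c =>
    obtain ⟨C, hC⟩ := exists_abs_integral_prod_mul_pow_sub_le μ k s
    refine ⟨|c| * C, fun n hn p q h S hS a ha => ?_⟩
    simp only [Polynomial.eval_monomial, mul_left_comm _ c]
    rw [integral_const_mul, integral_const_mul, ← mul_sub, abs_mul, mul_div_assoc]
    exact mul_le_mul_of_nonneg_left (hC n hn p q h S hS a ha) (abs_nonneg c)

theorem IsUnitFamily.abs_integral_prod_mul_comp_sub_le {Ω : Type*} [MeasurableSpace Ω]
    {μ : Measure Ω} [IsProbabilityMeasure μ] {n : ℕ} {p : Fin n → Ω → ℝ} (h : IsUnitFamily μ p)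
    (S : Finset (Fin n)) {φ ψ : ℝ → ℝ} (hφ : Continuous φ) (hψ : Continuous ψ) {ε : ℝ}
    (hε : ∀ x ∈ Icc (-1 : ℝ) 1, |φ x - ψ x| ≤ ε) {a : ℝ} (ha : a ∈ Icc (0 : ℝ) 1) :
    |∫ x, (∏ i ∈ S, p i x) * φ (familyMean p x - a) ∂μ -
      ∫ x, (∏ i ∈ S, p i x) * ψ (familyMean p x - a) ∂μ| ≤ ε := by
  rw [← integral_sub (h.integrable_prod_mul_comp S hφ ha) (h.integrable_prod_mul_comp S hψ ha)]
  have := norm_integral_le_of_norm_le_const (μ := μ) (C := ε)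
    (f := fun x => (∏ i ∈ S, p i x) * φ (familyMean p x - a) -
      (∏ i ∈ S, p i x) * ψ (familyMean p x - a)) ?_
  · simpa using this
  filter_upwards [h.ae_abs_prod_le_one S, h.ae_abs_familyMean_sub_le_one ha] with x h1 h2
  rw [← mul_sub, Real.norm_eq_abs, abs_mul]
  have h3 := hε _ (abs_le.1 h2)
  calc _ ≤ 1 * |φ (familyMean p x - a) - ψ (familyMean p x - a)| := by gcongr
    _ ≤ ε := by rwa [one_mul]

/-- Families with equal square-free moments asymptotically assign the same integrals to
continuous functions of the mean, also in the presence of a product of `s` members. -/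
theorem exists_forall_abs_integral_prod_mul_comp_sub_le {Ω : Type*} [MeasurableSpace Ω]
    (μ : Measure Ω) [IsProbabilityMeasure μ] {φ : ℝ → ℝ} (hφ : Continuous φ) (s : ℕ) {ε : ℝ}
    (hε : 0 < ε) :
    ∃ N : ℕ, ∀ n : ℕ, N ≤ n → ∀ p q : Fin n → Ω → ℝ, HaveEqualMoments μ p q →
      ∀ S : Finset (Fin n), S.card = s → ∀ a ∈ Icc (0 : ℝ) 1,
        |∫ x, (∏ i ∈ S, p i x) * φ (familyMean p x - a) ∂μ -
          ∫ x, (∏ i ∈ S, q i x) * φ (familyMean q x - a) ∂μ| ≤ ε := by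
  obtain ⟨P, hP⟩ := exists_polynomial_near_of_continuousOn (-1) 1 φ hφ.continuousOn (ε / 3)
    (by positivity)
  obtain ⟨C, hC⟩ := exists_abs_integral_prod_mul_eval_sub_le μ P s
  obtain ⟨N, hN⟩ := exists_nat_gt (C / (ε / 3))
  refine ⟨N + 1, fun n hn p q h S hS a ha => ?_⟩
  have hn' : (0 : ℝ) < n := by exact_mod_cast (by omega : 0 < n)
  have hle : C / n ≤ ε / 3 := by
    rw [div_lt_iff₀ (by positivity)] at hN
    rw [div_le_iff₀ hn']
    have : (N : ℝ) ≤ n := by exact_mod_cast (by omega : N ≤ n)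
    nlinarith
  have hP' : ∀ x ∈ Icc (-1 : ℝ) 1, |φ x - P.eval x| ≤ ε / 3 := fun x hx => by
    rw [abs_sub_comm]; exact (hP x hx).le
  have h1 := abs_le.1 (h.left.abs_integral_prod_mul_comp_sub_le S hφ P.continuous hP' ha)
  have h2 := abs_le.1 (h.right.abs_integral_prod_mul_comp_sub_le S hφ P.continuous hP' ha)
  have h3 := abs_le.1 ((hC n (by omega) p q h S hS a ha).trans hle)
  exact abs_le.2 ⟨by linarith [h1.1, h2.2, h3.1], by linarith [h1.2, h2.1, h3.2]⟩

/-! ### Uniform slopes of items and of their means -/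

/-- On every `[α, β] ⊆ (0, 1)` the difference quotients of the functions `P n i` lie between two
positive constants independent of `(n, i)`. -/
def HasUniformSlopes (n₀ : ℕ) (P : IRFArray) : Prop :=
  ∀ α β : ℝ, 0 < α → α < β → β < 1 → ∃ m M : ℝ, 0 < m ∧ 0 < M ∧
    ∀ n, n₀ ≤ n → ∀ i : Fin n, ∀ s t : ℝ, α ≤ s → s ≤ t → t ≤ β →
      m * (t - s) ≤ P n i t - P n i s ∧ P n i t - P n i s ≤ M * (t - s)

theorem DerivBounds.hasUniformSlopes {n₀ : ℕ} {P : IRFArray} (h : DerivBounds n₀ P) :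
    HasUniformSlopes n₀ P := by
  intro α β hα hαβ hβ
  obtain ⟨m, M, hm, hmM⟩ := h.2 α β hα hαβ hβ
  refine ⟨m, max M 1, hm, by positivity, fun n hn i s t hs hst ht => ?_⟩
  have hsub : Icc α β ⊆ Ioo (0 : ℝ) 1 := fun x hx => ⟨hα.trans_le hx.1, hx.2.trans_lt hβ⟩
  have hd : DifferentiableOn ℝ (P n i) (Icc α β) := (h.1 n hn i).1.mono hsub
  have hs' : s ∈ Icc α β := ⟨hs, hst.trans ht⟩
  have ht' : t ∈ Icc α β := ⟨hs.trans hst, ht⟩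
  exact ⟨(convex_Icc α β).mul_sub_le_image_sub_of_le_deriv hd.continuousOn
      (hd.mono interior_subset) (fun x hx => (hmM n hn i x (interior_subset hx)).1.le)
      s hs' t ht' hst,
    (convex_Icc α β).image_sub_le_mul_sub_of_deriv_le hd.continuousOn
      (hd.mono interior_subset)
      (fun x hx => (hmM n hn i x (interior_subset hx)).2.le.trans (le_max_left _ _))
      s hs' t ht' hst⟩

theorem familyMean_sub_mem_Icc {n : ℕ} (hn : 0 < n) {p : Fin n → ℝ → ℝ} {s t c C : ℝ}
    (h : ∀ i, c ≤ p i t - p i s ∧ p i t - p i s ≤ C) :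
    c ≤ familyMean p t - familyMean p s ∧ familyMean p t - familyMean p s ≤ C := by
  have hn' : (0 : ℝ) < n := by exact_mod_cast hn
  have hsub : familyMean p t - familyMean p s = (∑ i, (p i t - p i s)) / n := by
    rw [familyMean, familyMean, ← sub_div, Finset.sum_sub_distrib]
  rw [hsub, le_div_iff₀ hn', div_le_iff₀ hn']
  constructor
  · calc c * n = ∑ _i : Fin n, c := by simp [mul_comm]
      _ ≤ _ := Finset.sum_le_sum fun i _ => (h i).1
  · calc _ ≤ ∑ _i : Fin n, C := Finset.sum_le_sum fun i _ => (h i).2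
      _ = C * n := by simp [mul_comm]

theorem HasUniformSlopes.familyMean {n₀ : ℕ} {P : IRFArray} (h : HasUniformSlopes n₀ P)
    {α β : ℝ} (hα : 0 < α) (hαβ : α < β) (hβ : β < 1) : ∃ m M : ℝ, 0 < m ∧ 0 < M ∧
      ∀ n, n₀ ≤ n → 0 < n → ∀ s t : ℝ, α ≤ s → s ≤ t → t ≤ β →
        m * (t - s) ≤ familyMean (P n) t - familyMean (P n) s ∧
          familyMean (P n) t - familyMean (P n) s ≤ M * (t - s) := by
  obtain ⟨m, M, hm, hM, hmM⟩ := h α β hα hαβ hβ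
  exact ⟨m, M, hm, hM, fun n hn hn' s t hs hst ht =>
    familyMean_sub_mem_Icc hn' fun i => hmM n hn i s t hs hst ht⟩

theorem HasUniformSlopes.monotoneOn_familyMean {n₀ : ℕ} {P : IRFArray}
    (h : HasUniformSlopes n₀ P) {n : ℕ} (hn : n₀ ≤ n) (hn' : 0 < n) :
    MonotoneOn (_root_.familyMean (P n)) (Ioo 0 1) := by
  intro s hs t ht hst
  -- The right end lies beyond `t`, so the interval is nondegenerate even when `s = t`.
  obtain ⟨m, M, hm, -, hmM⟩ := h.familyMean (α := s) (β := (t + 1) / 2) hs.1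
    (by linarith [ht.2]) (by linarith [ht.2])
  have := (hmM n hn hn' s t le_rfl hst (by linarith [ht.2])).1
  have : 0 ≤ m * (t - s) := mul_nonneg hm.le (sub_nonneg.2 hst)
  linarith

/-! ### The uniform trait and matched arrays -/

/-- The uniform distribution on `(0, 1)`. -/
noncomputable abbrev uniformUnit : Measure ℝ := volume.restrict (Ioo 0 1)

instance : IsProbabilityMeasure uniformUnit := ⟨by simp [uniformUnit]⟩

theorem UniformEndpoints.mem_Icc {n₀ : ℕ} {P : IRFArray} (he : UniformEndpoints n₀ P) :
    ∀ n, n₀ ≤ n → ∀ θ ∈ Ioo (0 : ℝ) 1, ∀ i, P n i θ ∈ Icc (0 : ℝ) 1 := by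
  obtain ⟨κ, γ, h, -⟩ := he
  intro n hn θ hθ i
  obtain ⟨h0, -, h1, hx⟩ := h n hn i
  exact ⟨h0.trans (hx θ hθ).1, (hx θ hθ).2.trans h1⟩

theorem isUnitFamily_uniformUnit {n₀ : ℕ} {P : IRFArray} (hd : DerivBounds n₀ P)
    (he : UniformEndpoints n₀ P) {n : ℕ} (hn : n₀ ≤ n) : IsUnitFamily uniformUnit (P n) := by
  exact ⟨fun i => (hd.1 n hn i).1.continuousOn.aestronglyMeasurable measurableSet_Ioo,
    fun i => (ae_restrict_mem measurableSet_Ioo).mono fun x hx => he.mem_Icc n hn x hx i⟩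

theorem integral_mul_uniformDensity (f : ℝ → ℝ) :
    ∫ θ, f θ * uniformDensity θ = ∫ θ, f θ ∂uniformUnit := by
  rw [← integral_indicator measurableSet_Ioo]
  congr 1 with θ
  by_cases hθ : θ ∈ Ioo (0 : ℝ) 1 <;> simp [uniformDensity, hθ]

theorem haveEqualMoments_of_isModel {n₀ : ℕ} {P Pstar : IRFArray} {F : ManifestArray}
    (hP : IsModel n₀ P uniformDensity F) (hPstar : IsModel n₀ Pstar uniformDensity F)
    (hPd : DerivBounds n₀ P) (hPstard : DerivBounds n₀ Pstar)
    (hPe : UniformEndpoints n₀ P) (hPstare : UniformEndpoints n₀ Pstar) {n : ℕ} (hn : n₀ ≤ n) :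
    HaveEqualMoments uniformUnit (P n) (Pstar n) := by
  refine ⟨isUnitFamily_uniformUnit hPd hPe hn, isUnitFamily_uniformUnit hPstard hPstare hn,
    fun S => ?_⟩
  rcases S.eq_empty_or_nonempty with rfl | hS
  · simp
  · rw [← integral_mul_uniformDensity, ← integral_mul_uniformDensity, ← hP n hn S hS,
      ← hPstar n hn S hS]

theorem integrable_indicator_Ioo_uniformUnit (a b c : ℝ) :
    Integrable ((Ioo a b).indicator fun _ => c) uniformUnit :=
  (integrable_const c).indicator measurableSet_Ioo

theorem integral_indicator_Ioo_uniformUnit {a b : ℝ} (ha : 0 ≤ a) (hab : a ≤ b) (hb : b ≤ 1)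
    (c : ℝ) : ∫ θ, (Ioo a b).indicator (fun _ => c) θ ∂uniformUnit = (b - a) * c := by
  rw [integral_indicator_const _ measurableSet_Ioo, measureReal_restrict_apply measurableSet_Ioo,
    inter_eq_left.2 (Ioo_subset_Ioo ha hb), Real.volume_real_Ioo_of_le hab, smul_eq_mul]

/-- Two arrays of regular item response functions that have the same moments in each row. -/
structure AreMatched (n₀ : ℕ) (P Q : IRFArray) : Prop where
  slopes_left : HasUniformSlopes n₀ P
  slopes_right : HasUniformSlopes n₀ Q
  mem_left : ∀ n, n₀ ≤ n → ∀ θ ∈ Ioo (0 : ℝ) 1, ∀ i, P n i θ ∈ Icc (0 : ℝ) 1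
  mem_right : ∀ n, n₀ ≤ n → ∀ θ ∈ Ioo (0 : ℝ) 1, ∀ i, Q n i θ ∈ Icc (0 : ℝ) 1
  moments : ∀ n, n₀ ≤ n → HaveEqualMoments uniformUnit (P n) (Q n)

/-! ### Tent functions -/

/-- The tent function of height `1` supported on `[-ρ, ρ]`. -/
noncomputable def tent (ρ x : ℝ) : ℝ := max 0 (1 - |x| / ρ)

theorem continuous_tent (ρ : ℝ) : Continuous (tent ρ) := by
  unfold tent
  fun_prop

theorem tent_nonneg (ρ x : ℝ) : 0 ≤ tent ρ x := le_max_left _ _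

theorem tent_eq_zero {ρ x : ℝ} (hρ : 0 < ρ) (hx : ρ ≤ |x|) : tent ρ x = 0 :=
  max_eq_left (by rw [sub_nonpos, one_le_div hρ]; exact hx)

theorem half_le_tent {ρ x : ℝ} (hρ : 0 < ρ) (hx : |x| ≤ ρ / 2) : 1 / 2 ≤ tent ρ x := by
  refine le_max_of_le_right ?_
  have : |x| / ρ ≤ 1 / 2 := by rw [div_le_iff₀ hρ]; linarith
  linarith

theorem abs_tent_sub_tent_le {ρ : ℝ} (hρ : 0 < ρ) (x y : ℝ) :
    |tent ρ x - tent ρ y| ≤ |x - y| / ρ := by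
  calc |tent ρ x - tent ρ y| ≤ |(1 - |x| / ρ) - (1 - |y| / ρ)| := by
        simpa [tent] using abs_max_sub_max_le_max 0 (1 - |x| / ρ) 0 (1 - |y| / ρ)
    _ = |(|y| - |x|)| / ρ := by
        rw [sub_sub_sub_cancel_left, ← sub_div, abs_div, abs_of_pos hρ]
    _ ≤ |x - y| / ρ := by
        rw [abs_sub_comm x y]
        exact div_le_div_of_nonneg_right (abs_abs_sub_abs_le _ _) hρ.le

/-! ### Closeness of the row means -/

namespace AreMatched

variable {n₀ : ℕ} {P Q : IRFArray}

theorem symm (h : AreMatched n₀ P Q) : AreMatched n₀ Q P :=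
  ⟨h.slopes_right, h.slopes_left, h.mem_right, h.mem_left, fun n hn => (h.moments n hn).symm⟩

/-- The row means are the quantile functions of their distributions, and the latter are
asymptotically equal. -/
theorem exists_forall_familyMean_le_add (h : AreMatched n₀ P Q) {α β δ : ℝ} (hα : 0 < α)
    (hαβ : α < β) (hβ : β < 1) (hδ : 0 < δ) :
    ∃ N : ℕ, n₀ ≤ N ∧ ∀ n, N ≤ n → ∀ θ ∈ Icc α β,
      familyMean (P n) θ ≤ familyMean (Q n) θ + δ := by
  obtain ⟨m, M, -, hM, hmM⟩ := h.slopes_right.familyMean (β := (β + 1) / 2) hα (by linarith)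
    (by linarith)
  -- A continuous cutoff: 1 on `(-∞, 0]`, 0 on `[δ / 2, ∞)`.
  set φ : ℝ → ℝ := fun x => max 0 (min 1 (1 - x / (δ / 2))) with hφ
  have hφc : Continuous φ := by fun_prop
  -- Over `[θ, θ + r]` the mean of `Q` gains at most `δ / 2`, so it stays below the level `a` chosen
  -- later. The cutoff then has integral at least `θ + r` for `Q` but at most `θ` for `P`, against a
  -- tolerance of `r / 2`.
  obtain ⟨r, hr, hrM, hrβ⟩ : ∃ r : ℝ, 0 < r ∧ M * r ≤ δ / 2 ∧ r ≤ (1 - β) / 2 := by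
    refine ⟨min (δ / 2 / M) ((1 - β) / 2), lt_min (by positivity) (by linarith), ?_,
      min_le_right _ _⟩
    calc _ ≤ M * (δ / 2 / M) := by gcongr; exact min_le_left _ _
      _ = δ / 2 := by field_simp
  obtain ⟨N, hN⟩ := exists_forall_abs_integral_prod_mul_comp_sub_le uniformUnit hφc 0
    (half_pos hr)
  refine ⟨N + n₀ + 1, by omega, fun n hn θ hθ => ?_⟩
  have hn₀ : n₀ ≤ n := by omega
  have hθ' : θ ∈ Ioo (0 : ℝ) 1 := ⟨hα.trans_le hθ.1, hθ.2.trans_lt hβ⟩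
  by_contra! hlt
  have hPθ := familyMean_mem_Icc (h.mem_left n hn₀ θ hθ')
  have hQθ := familyMean_mem_Icc (h.mem_right n hn₀ θ hθ')
  set a := familyMean (Q n) θ + δ / 2 with ha
  have haI : a ∈ Icc (0 : ℝ) 1 := ⟨by linarith [hQθ.1], by linarith [hPθ.2]⟩
  have hle := hN n (by omega) (P n) (Q n) (h.moments n hn₀) ∅ rfl a haI
  simp only [Finset.prod_empty, one_mul] at hle
  have hiP := (h.moments n hn₀).left.integrable_prod_mul_comp ∅ hφc haI
  have hiQ := (h.moments n hn₀).right.integrable_prod_mul_comp ∅ hφc haI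
  simp only [Finset.prod_empty, one_mul] at hiP hiQ
  have hPle : ∫ t, φ (familyMean (P n) t - a) ∂uniformUnit ≤ θ := by
    calc _ ≤ ∫ t, (Ioo 0 θ).indicator (fun _ => (1 : ℝ)) t ∂uniformUnit := by
          refine integral_mono_ae hiP (integrable_indicator_Ioo_uniformUnit 0 θ 1) ?_
          filter_upwards [ae_restrict_mem measurableSet_Ioo] with t ht
          by_cases htθ : t < θ
          · rw [indicator_of_mem (s := Ioo _ _) ⟨ht.1, htθ⟩]
            exact max_le zero_le_one (min_le_left _ _)
          · rw [indicator_of_notMem fun hh => htθ hh.2]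
            have := h.slopes_left.monotoneOn_familyMean hn₀ (by omega) hθ' ht (not_lt.1 htθ)
            refine max_le le_rfl ((min_le_right _ _).trans ?_)
            rw [sub_nonpos, one_le_div (by positivity)]
            linarith
      _ = θ := by
        rw [integral_indicator_Ioo_uniformUnit le_rfl hθ'.1.le hθ'.2.le]; ring
  have hQle : θ + r ≤ ∫ t, φ (familyMean (Q n) t - a) ∂uniformUnit := by
    calc θ + r = ∫ t, (Ioo 0 (θ + r)).indicator (fun _ => (1 : ℝ)) t ∂uniformUnit := by
          rw [integral_indicator_Ioo_uniformUnit le_rfl (by linarith [hθ'.1])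
            (by linarith [hθ.2])]; ring
      _ ≤ _ := by
          refine integral_mono_ae (integrable_indicator_Ioo_uniformUnit 0 (θ + r) 1) hiQ ?_
          filter_upwards [ae_restrict_mem measurableSet_Ioo] with t ht
          by_cases htθ : t < θ + r
          · rw [indicator_of_mem (s := Ioo _ _) ⟨ht.1, htθ⟩]
            have h1 := h.slopes_right.monotoneOn_familyMean hn₀ (by omega) ht
              (⟨by linarith [hθ'.1], by linarith [hθ.2]⟩ : θ + r ∈ Ioo (0 : ℝ) 1) htθ.le
            have h2 := (hmM n hn₀ (by omega) θ (θ + r) hθ.1 (by linarith)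
              (by linarith [hθ.2])).2
            rw [add_sub_cancel_left] at h2
            refine le_max_of_le_right (le_min le_rfl ?_)
            have : (familyMean (Q n) t - a) / (δ / 2) ≤ 0 :=
              div_nonpos_of_nonpos_of_nonneg (by linarith) (by positivity)
            linarith
          · rw [indicator_of_notMem fun hh => htθ hh.2]
            exact le_max_left _ _
  linarith [(abs_le.1 hle).1]

theorem exists_forall_abs_familyMean_sub_le (h : AreMatched n₀ P Q) {α β δ : ℝ} (hα : 0 < α)
    (hαβ : α < β) (hβ : β < 1) (hδ : 0 < δ) :
    ∃ N : ℕ, n₀ ≤ N ∧ ∀ n, N ≤ n → ∀ θ ∈ Icc α β,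
      |familyMean (P n) θ - familyMean (Q n) θ| ≤ δ := by
  obtain ⟨N₁, hN₁, h₁⟩ := h.exists_forall_familyMean_le_add hα hαβ hβ hδ
  obtain ⟨N₂, hN₂, h₂⟩ := h.symm.exists_forall_familyMean_le_add hα hαβ hβ hδ
  refine ⟨max N₁ N₂, le_max_of_le_left hN₁, fun n hn θ hθ => abs_le.2 ⟨?_, ?_⟩⟩
  · linarith [h₂ n (le_of_max_le_right hn) θ hθ]
  · linarith [h₁ n (le_of_max_le_left hn) θ hθ]

theorem abs_familyMean_sub_le_one (h : AreMatched n₀ P Q) {n : ℕ} (hn : n₀ ≤ n) :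
    ∀ θ ∈ Ioo (0 : ℝ) 1, |familyMean (P n) θ - familyMean (Q n) θ| ≤ 1 := by
  intro θ hθ
  have hp := familyMean_mem_Icc (h.mem_left n hn θ hθ)
  have hq := familyMean_mem_Icc (h.mem_right n hn θ hθ)
  exact abs_le.2 ⟨by linarith [hp.1, hq.2], by linarith [hp.2, hq.1]⟩

theorem integrable_abs_familyMean_sub (h : AreMatched n₀ P Q) {n : ℕ} (hn : n₀ ≤ n) :
    Integrable (fun θ => |familyMean (P n) θ - familyMean (Q n) θ|) uniformUnit := by
  refine Integrable.of_bound (((h.moments n hn).left.aestronglyMeasurable_familyMean.sub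
    (h.moments n hn).right.aestronglyMeasurable_familyMean).norm) 1 ?_
  filter_upwards [ae_restrict_mem measurableSet_Ioo] with θ hθ
  rw [Real.norm_eq_abs, abs_abs]
  exact h.abs_familyMean_sub_le_one hn θ hθ

/-- Uniform closeness holds away from the endpoints; the two remaining end intervals are short and
the difference there is at most 1. -/
theorem exists_forall_integral_abs_familyMean_sub_le (h : AreMatched n₀ P Q) {η : ℝ}
    (hη : 0 < η) : ∃ N : ℕ, n₀ ≤ N ∧ ∀ n, N ≤ n →
      ∫ θ, |familyMean (P n) θ - familyMean (Q n) θ| ∂uniformUnit ≤ η := by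
  obtain ⟨α, hα, hαη, hα'⟩ : ∃ α : ℝ, 0 < α ∧ α ≤ η / 4 ∧ α ≤ 1 / 4 :=
    ⟨min (η / 4) (1 / 4), by positivity, min_le_left _ _, min_le_right _ _⟩
  obtain ⟨N, hN, hle⟩ := h.exists_forall_abs_familyMean_sub_le hα (β := 1 - α) (by linarith)
    (by linarith) (half_pos hη)
  refine ⟨N, hN, fun n hn => ?_⟩
  have hn₀ := hN.trans hn
  have h1 := integrable_indicator_Ioo_uniformUnit 0 α 1
  have h2 := integrable_indicator_Ioo_uniformUnit (1 - α) 1 1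
  have h3 : Integrable (fun _ : ℝ => η / 2) uniformUnit := integrable_const _
  have hb := h.abs_familyMean_sub_le_one hn₀
  have hi := h.integrable_abs_familyMean_sub hn₀
  calc _ ≤ ∫ θ, (η / 2 + (Ioo 0 α).indicator (fun _ => (1 : ℝ)) θ +
        (Ioo (1 - α) 1).indicator (fun _ => (1 : ℝ)) θ) ∂uniformUnit := by
        refine integral_mono_ae hi ((h3.add h1).add h2) ?_
        filter_upwards [ae_restrict_mem measurableSet_Ioo] with θ hθ
        have e1 : 0 ≤ (Ioo 0 α).indicator (fun _ => (1 : ℝ)) θ :=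
          indicator_nonneg (fun _ _ => zero_le_one) θ
        have e2 : 0 ≤ (Ioo (1 - α) 1).indicator (fun _ => (1 : ℝ)) θ :=
          indicator_nonneg (fun _ _ => zero_le_one) θ
        by_cases hα : θ < α
        · rw [indicator_of_mem (s := Ioo _ _) ⟨hθ.1, hα⟩]
          linarith [hb θ hθ]
        by_cases hβ : 1 - α < θ
        · rw [indicator_of_mem (s := Ioo (1 - α) 1) ⟨hβ, hθ.2⟩]
          linarith [hb θ hθ]
        · linarith [hle n hn θ ⟨not_lt.1 hα, not_lt.1 hβ⟩]
    _ = η / 2 + α + α := by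
        rw [integral_add (f := fun θ => η / 2 + (Ioo 0 α).indicator (fun _ => (1 : ℝ)) θ)
            (h3.add h1) h2, integral_add h3 h1,
          integral_indicator_Ioo_uniformUnit le_rfl hα.le (by linarith),
          integral_indicator_Ioo_uniformUnit (by linarith) (by linarith) le_rfl]
        simp
    _ ≤ η := by linarith

/-! ### Localisation at a trait value -/

theorem exists_forall_le_add (h : AreMatched n₀ P Q) {α β ε : ℝ} (hα : 0 < α)
    (hαβ : α < β) (hβ : β < 1) (hε : 0 < ε) :
    ∃ N : ℕ, n₀ ≤ N ∧ ∀ n, N ≤ n → ∀ i, ∀ θ ∈ Icc α β, P n i θ ≤ Q n i θ + ε := by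
  have hα' : 0 < α / 2 := by linarith
  have hαβ' : α / 2 < (β + 1) / 2 := by linarith
  have hβ' : (β + 1) / 2 < 1 := by linarith
  obtain ⟨l, L, hl, hL, hPL⟩ := h.slopes_left _ _ hα' hαβ' hβ'
  obtain ⟨l', L', hl', hL', hQL⟩ := h.slopes_right _ _ hα' hαβ' hβ'
  obtain ⟨m, M, hm, hM, hmM⟩ := h.slopes_left.familyMean hα' hαβ' hβ'
  -- Within distance `r` of θ, a gap `P - Q > ε` shrinks by at most `ε / 2`.
  obtain ⟨r, hr, hrL, hrα, hrβ⟩ : ∃ r : ℝ, 0 < r ∧ (L + L') * r ≤ ε / 2 ∧ r ≤ α / 2 ∧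
      r ≤ (1 - β) / 2 := by
    refine ⟨min (ε / 2 / (L + L')) (min (α / 2) ((1 - β) / 2)),
      lt_min (by positivity) (lt_min hα' (by linarith)), ?_,
      (min_le_right _ _).trans (min_le_left _ _), (min_le_right _ _).trans (min_le_right _ _)⟩
    calc _ ≤ (L + L') * (ε / 2 / (L + L')) := by gcongr; exact min_le_left _ _
      _ = ε / 2 := by field_simp
  -- The mean of `P` moves by at least `m * r` at distance `r`, so the tent of this width vanishes
  -- farther out.
  obtain ⟨ρ, hρ⟩ : ∃ ρ, ρ = m * r := ⟨_, rfl⟩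
  have hρ₀ : 0 < ρ := hρ ▸ mul_pos hm hr
  -- Within `d` of θ the mean moves by at most `ρ / 2`, where the tent is at least 1/2.
  obtain ⟨d, hd, hdr, hdM⟩ : ∃ d : ℝ, 0 < d ∧ d ≤ r ∧ M * d ≤ ρ / 2 := by
    refine ⟨min r (ρ / 2 / M), by positivity, min_le_left _ _, ?_⟩
    calc _ ≤ M * (ρ / 2 / M) := by gcongr; exact min_le_right _ _
      _ = ρ / 2 := by field_simp
  -- The gap contributes at least `2 * d * (ε / 4) = 4 * c`, while the two errors are at most `c`
  -- each.
  obtain ⟨c, hc⟩ : ∃ c, c = ε * d / 8 := ⟨_, rfl⟩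
  have hc₀ : 0 < c := hc ▸ by positivity
  obtain ⟨N₁, hN₁⟩ := exists_forall_abs_integral_prod_mul_comp_sub_le uniformUnit
    (continuous_tent ρ) 1 hc₀
  obtain ⟨N₂, hN₂, hmean⟩ := h.exists_forall_integral_abs_familyMean_sub_le
    -- The factor `ρ` offsets the Lipschitz constant `1 / ρ` of the tent.
    (η := c * ρ) (by positivity)
  refine ⟨N₁ + N₂, by omega, fun n hn i θ hθ => ?_⟩
  have hn₀ : n₀ ≤ n := by omega
  have hn' : 0 < n := i.pos
  have hθ' : θ ∈ Ioo (0 : ℝ) 1 := ⟨hα.trans_le hθ.1, hθ.2.trans_lt hβ⟩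
  by_contra! hlt
  have hmono := h.slopes_left.monotoneOn_familyMean hn₀ hn'
  obtain ⟨a, ha⟩ : ∃ a, a = familyMean (P n) θ := ⟨_, rfl⟩
  have haI : a ∈ Icc (0 : ℝ) 1 := ha ▸ familyMean_mem_Icc (h.mem_left n hn₀ θ hθ')
  have hfar : ∀ t ∈ Ioo (0 : ℝ) 1, r ≤ |t - θ| → tent ρ (familyMean (P n) t - a) = 0 := by
    intro t ht hrt
    refine tent_eq_zero hρ₀ ?_
    rcases le_abs.1 hrt with h1 | h1
    · have h2 := hmono (⟨by linarith [hθ'.1], by linarith [hθ.2]⟩ : θ + r ∈ Ioo (0 : ℝ) 1) ht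
        (by linarith)
      have h3 := (hmM n hn₀ hn' θ (θ + r) (by linarith [hθ.1]) (by linarith)
        (by linarith [hθ.2])).1
      rw [add_sub_cancel_left, ← hρ] at h3
      exact le_abs.2 (.inl (by linarith))
    · have h2 := hmono ht (⟨by linarith [hθ.1], by linarith [hθ'.2]⟩ : θ - r ∈ Ioo (0 : ℝ) 1)
        (by linarith)
      have h3 := (hmM n hn₀ hn' (θ - r) θ (by linarith [hθ.1]) (by linarith)
        (by linarith [hθ.2])).1
      rw [sub_sub_cancel, ← hρ] at h3
      exact le_abs.2 (.inr (by linarith))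
  have hdiff : ∀ t, |t - θ| < r → ε / 2 ≤ P n i t - Q n i t := by
    intro t ht
    obtain ⟨ht1, ht2⟩ := abs_lt.1 ht
    rcases le_total θ t with hle | hle
    · have h1 := (hPL n hn₀ i θ t (by linarith [hθ.1]) hle (by linarith [hθ.2])).1
      have h2 := (hQL n hn₀ i θ t (by linarith [hθ.1]) hle (by linarith [hθ.2])).2
      have h3 : 0 ≤ l * (t - θ) := mul_nonneg hl.le (by linarith)
      have h4 : L' * (t - θ) ≤ (L + L') * r := by gcongr <;> linarith
      linarith
    · have h1 := (hPL n hn₀ i t θ (by linarith [hθ.1]) hle (by linarith [hθ.2])).2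
      have h2 := (hQL n hn₀ i t θ (by linarith [hθ.1]) hle (by linarith [hθ.2])).1
      have h3 : 0 ≤ l' * (θ - t) := mul_nonneg hl'.le (by linarith)
      have h4 : L * (θ - t) ≤ (L + L') * r := by gcongr <;> linarith
      linarith
  have hnear : ∀ t, |t - θ| < d → 1 / 2 ≤ tent ρ (familyMean (P n) t - a) := by
    intro t ht
    obtain ⟨ht1, ht2⟩ := abs_lt.1 ht
    refine half_le_tent hρ₀ (abs_le.2 ?_)
    rcases le_total θ t with hle | hle
    · have h1 := hmM n hn₀ hn' θ t (by linarith [hθ.1]) hle (by linarith [hθ.2])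
      have h3 : 0 ≤ m * (t - θ) := mul_nonneg hm.le (by linarith)
      have h4 : M * (t - θ) ≤ M * d := by gcongr
      constructor <;> linarith
    · have h1 := hmM n hn₀ hn' t θ (by linarith [hθ.1]) hle (by linarith [hθ.2])
      have h3 : 0 ≤ m * (θ - t) := mul_nonneg hm.le (by linarith)
      have h4 : M * (θ - t) ≤ M * d := by gcongr; linarith
      constructor <;> linarith
  have hu := (h.moments n hn₀).right
  have hPP := (h.moments n hn₀).left.integrable_prod_mul_comp {i} (continuous_tent ρ) haI
  have hQQ := hu.integrable_prod_mul_comp {i} (continuous_tent ρ) haI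
  have hP := (h.moments n hn₀).left.integrable_prod_mul_comp ∅ (continuous_tent ρ) haI
  have h12 := hN₁ n (by omega) (P n) (Q n) (h.moments n hn₀) {i} (by simp) a haI
  simp only [Finset.prod_singleton, Finset.prod_empty, one_mul] at hPP hQQ hP h12
  -- The mixed integral, items of `Q` localised by the mean of `P`, links the two arrays.
  have hQP : Integrable (fun t => Q n i t * tent ρ (familyMean (P n) t - a)) uniformUnit := by
    refine hP.bdd_mul (c := 1) (hu.aestronglyMeasurable i) ?_
    filter_upwards [hu.mem_Icc i] with t ht
    rw [Real.norm_eq_abs, abs_of_nonneg ht.1]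
    exact ht.2
  have hlow : 4 * c ≤ ∫ t, (P n i t * tent ρ (familyMean (P n) t - a) -
      Q n i t * tent ρ (familyMean (P n) t - a)) ∂uniformUnit := by
    calc 4 * c = ∫ t, (Ioo (θ - d) (θ + d)).indicator (fun _ => ε / 4) t ∂uniformUnit := by
          rw [integral_indicator_Ioo_uniformUnit (by linarith [hθ.1]) (by linarith)
            (by linarith [hθ.2]), hc]
          ring
      _ ≤ _ := by
          refine integral_mono_ae (integrable_indicator_Ioo_uniformUnit (θ - d) (θ + d) (ε / 4))
            (hPP.sub hQP) ?_
          filter_upwards [ae_restrict_mem measurableSet_Ioo] with t ht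
          rw [← sub_mul]
          by_cases htd : t ∈ Ioo (θ - d) (θ + d)
          · rw [indicator_of_mem htd]
            have htd' : |t - θ| < d := abs_lt.2 ⟨by linarith [htd.1], by linarith [htd.2]⟩
            calc ε / 4 = ε / 2 * (1 / 2) := by ring
              _ ≤ _ := mul_le_mul (hdiff t (htd'.trans_le hdr)) (hnear t htd') (by norm_num)
                ((half_pos hε).le.trans (hdiff t (htd'.trans_le hdr)))
          · rw [indicator_of_notMem htd]
            rcases le_or_gt r |t - θ| with hrt | hrt
            · rw [hfar t ht hrt, mul_zero]
            · exact mul_nonneg ((half_pos hε).le.trans (hdiff t hrt)) (tent_nonneg _ _)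
  have hup : ∫ t, (Q n i t * tent ρ (familyMean (Q n) t - a) -
      Q n i t * tent ρ (familyMean (P n) t - a)) ∂uniformUnit ≤ c := by
    calc _ ≤ ∫ t, |familyMean (P n) t - familyMean (Q n) t| / ρ ∂uniformUnit := by
          refine integral_mono_ae (hQQ.sub hQP)
            ((h.integrable_abs_familyMean_sub hn₀).div_const ρ) ?_
          filter_upwards [hu.mem_Icc i] with t ht
          rw [← mul_sub]
          refine (le_abs_self _).trans ?_
          rw [abs_mul, abs_of_nonneg ht.1, abs_sub_comm]
          refine (mul_le_of_le_one_left (abs_nonneg _) ht.2).trans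
            ((abs_tent_sub_tent_le hρ₀ _ _).trans_eq ?_)
          rw [sub_sub_sub_cancel_right]
      _ ≤ c := by
          rw [integral_div, div_le_iff₀ hρ₀]
          exact hmean n (by omega)
  rw [integral_sub hPP hQP] at hlow
  rw [integral_sub hQQ hQP] at hup
  linarith [(abs_le.1 h12).2]

end AreMatched

/-! ### The main theorem -/

theorem theorem2 (n₀ : ℕ) (F : ManifestArray) (hF : ∀ n, n₀ ≤ n → IsProbabilityMeasure (F n))
    (P Pstar : IRFArray)
    (hP : IsModel n₀ P uniformDensity F) (hPstar : IsModel n₀ Pstar uniformDensity F)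
    (hPd : DerivBounds n₀ P) (hPstard : DerivBounds n₀ Pstar)
    (hPe : UniformEndpoints n₀ P) (hPstare : UniformEndpoints n₀ Pstar)
    (ε α β : ℝ) (hε : 0 < ε) (hα : 0 < α) (hαβ : α < β) (hβ : β < 1) :
    ∃ N : ℕ, n₀ ≤ N ∧ ∀ n, N ≤ n →
      (⨆ i : Fin n, ⨆ θ : Ioo α β, |P n i θ - Pstar n i θ|) < ε := by
  have h : AreMatched n₀ P Pstar := by
    refine ⟨hPd.hasUniformSlopes, hPstard.hasUniformSlopes, hPe.mem_Icc, hPstare.mem_Icc,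
      fun n hn => haveEqualMoments_of_isModel hP hPstar hPd hPstard hPe hPstare hn⟩
  obtain ⟨N₁, hN₁, h₁⟩ := h.exists_forall_le_add hα hαβ hβ (half_pos hε)
  obtain ⟨N₂, hN₂, h₂⟩ := h.symm.exists_forall_le_add hα hαβ hβ (half_pos hε)
  refine ⟨max N₁ N₂, le_max_of_le_left hN₁, fun n hn => ?_⟩
  -- `Real.iSup_le` also asks for a nonnegative bound, since an empty real supremum is 0; this
  -- covers `n = 0`.
  refine lt_of_le_of_lt (Real.iSup_le (fun i => Real.iSup_le (fun θ => ?_) (half_pos hε).le)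
    (half_pos hε).le) (half_lt_self hε)
  have hθ := Ioo_subset_Icc_self θ.2
  refine abs_le.2 ⟨?_, ?_⟩
  · linarith [h₂ n (le_of_max_le_right hn) i θ hθ]
  · linarith [h₁ n (le_of_max_le_left hn) i θ hθ]
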